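/- Let $G=(V,E)$ be a finite directed acyclic graph. A function $h:V\to\mathbb R$ is isotonic if $h(u)\le h(v)$ whenever there is a directed path from $u$ to $v$. For $f:V\to\mathbb R$ and positive weights $w:V\to(0,\infty)$, an $L_p$ isotonic regression of $(f,w)$, $1<p<\infty$, is an isotonic $g$ minimizing $\sum_{v\in V}\bigl(w(v)\,|f(v)-g(v)|\bigr)^p$ among isotonic functions, and an $L_\infty$ isotonic regression is an isotonic $g$ minimizing $\max_{v\in V} w(v)\,|f(v)-g(v)|$. Define: * $\mathsf{strict}^{\uparrow\infty}(f,w)$ is the limit, as $p\to\infty$, of the $L_p$ isotonic regressions of $(f,w)$. * For nonempty $S\subseteq V$, $\mathsf{wmean}^{\uparrow\infty}((f,w)|S)$ is the limit, as $p\to\infty$, of the minimizers $x\in\mathbb R$ of $\sum_{v\in S}\bigl(w(v)\,|f(v)-x|\bigr)^p$. * For isotonic $g,h$ write $g\prec h$ if there is $\alpha>0$ with $W_g(\alpha)<W_h(\alpha)$ and $W_g(\beta)=W_h(\beta)$ for all $\beta>\alpha$, where $W_g(\alpha)=\sum\{w(v): w(v)\,|g(v)-f(v)|\ge\alpha\}$.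 $\mathsf{lex}_\infty(f,w)$ is the isotonic $g$ with $g\prec h$ for every isotonic $h\ne g$. * A level set of an isotonic $g$ is a maximal weakly connected set of vertices on which $g$ is constant. Let $\mathcal A$ be an $L_\infty$ isotonic regression operator on $G$, i.e. a map that assigns to every $(f,w)$ an $L_\infty$ isotonic regression $\mathcal A(f,w)$ of $(f,w)$. Call $\mathcal A$ monotonic if for all $w$ and all $f\le g$ (pointwise), $\mathcal A(f,w)\le\mathcal A(g,w)$ pointwise; say that $\mathcal A$ preserves level set trimming if for every $(f,w)$ and every level set $L$ of $\mathcal A(f,w)$, the value of $\mathcal A(f,w)$ on $L$ is $\mathsf{wmean}^{\uparrow\infty}((f,w)|L)$. **Theorem.** If $\mathcal A$ is monotonic and preserves level set trimming, then for every $(f,w)$ the limit $\mathsf{strict}^{\uparrow\infty}(f,w)$ and the regression $\mathsf{lex}_\infty(f,w)$ exist and $\mathcal A(f,w)=\mathsf{strict}^{\uparrow\infty}(f,w)=\mathsf{lex}_\infty(f,w)$. Conversely, if $\mathcal A(f,w)=\mathsf{strict}^{\uparrow\infty}(f,w)$ for every $(f,w)$, then $\mathcal A$ is monotonic and preserves level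 set trimming. So these two properties characterize $\mathsf{strict}^{\uparrow\infty}$ among $L_\infty$ isotonic regression operators. -/

import Mathlib

open Filter Topology

namespace IsoReg

variable {V : Type*}

/-- The digraph has no directed cycle. -/
def Acyclic (G : Digraph V) : Prop :=
  ∀ v, ¬ Relation.TransGen G.Adj v v

/-- `h` is isotonic on `G`: if there is a path from `u` to `v` then `h u ≤ h v`. -/
def Isotonic (G : Digraph V) (h : V → ℝ) : Prop :=
  ∀ u v, Relation.TransGen G.Adj u v → h u ≤ h v

/-- `S` is a level set of `g`: a maximal weakly connected set of vertices on which `g` is constant.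
(`SimpleGraph.Connected` includes nonemptiness.) -/
def IsLevelSet (G : Digraph V) (g : V → ℝ) (S : Set V) : Prop :=
  Maximal (fun T : Set V =>
    (G.toSimpleGraphInclusive.induce T).Connected ∧ ∀ u ∈ T, ∀ v ∈ T, g u = g v) S

/-- The weighted `L_p` error, `0 < p < ∞`, of `g` as an approximation of `f` on the vertices in `S`
(without the `p`-th root): the sum of the `p`-th powers of the weighted errors. -/
noncomputable def lpError (p : ℝ) (f w : V → ℝ) (S : Finset V) (g : V → ℝ) : ℝ :=
  ∑ v ∈ S, (w v * |f v - g v|) ^ p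

/-- The weighted `L_∞` error of `g` as an approximation of `f`: the maximal weighted error.
(`V` is finite wherever this is used; the value is `0` if `V` is empty.) -/
noncomputable def linfError (f w : V → ℝ) (g : V → ℝ) : ℝ :=
  ⨆ v, w v * |f v - g v|

/-- `g` is an `L_p` isotonic regression of `(f, w)`, `0 < p < ∞`. -/
def IsLpRegression [Fintype V] (G : Digraph V) (p : ℝ) (f w g : V → ℝ) : Prop :=
  Isotonic G g ∧
    ∀ h, Isotonic G h → lpError p f w Finset.univ g ≤ lpError p f w Finset.univ h

/-- `g` is an `L_∞` isotonic regression of `(f, w)`. -/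
def IsLinfRegression (G : Digraph V) (f w g : V → ℝ) : Prop :=
  Isotonic G g ∧ ∀ h, Isotonic G h → linfError f w g ≤ linfError f w h

/-- `x` is a weighted `L_p` mean of `(f, w)` restricted to `S`, `0 < p < ∞`. -/
def IsWMean (p : ℝ) (f w : V → ℝ) (S : Finset V) (x : ℝ) : Prop :=
  ∀ y : ℝ, lpError p f w S (fun _ => x) ≤ lpError p f w S (fun _ => y)

/-- `c` is the limit, as `p ↗ ∞`, of the weighted `L_p` means of `(f, w)` restricted to `S`. -/
def IsWMeanUpInf (f w : V → ℝ) (S : Finset V) (c : ℝ) : Prop :=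
  ∃ m : ℝ → ℝ, (∀ p, 1 < p → IsWMean p f w S (m p)) ∧ Tendsto m atTop (𝓝 c)

/-- `g` is the strict `L_∞` isotonic regression of `(f, w)`: the limit, as `p ↗ ∞`, of the `L_p`
isotonic regressions of `(f, w)`. -/
def IsStrictUpInf [Fintype V] (G : Digraph V) (f w g : V → ℝ) : Prop :=
  ∃ r : ℝ → V → ℝ, (∀ p, 1 < p → IsLpRegression G p f w (r p)) ∧ Tendsto r atTop (𝓝 g)

/-- The total weight of the vertices where the weighted error of `g` is at least `α`. -/
noncomputable def weightAbove [Fintype V] (f w g : V → ℝ) (α : ℝ) : ℝ :=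
  ∑ v with α ≤ w v * |g v - f v|, w v

/-- `g` strictly precedes `h` in the lexical ordering of the errors in approximating `(f, w)`. -/
def LexLT [Fintype V] (f w g h : V → ℝ) : Prop :=
  ∃ α : ℝ, 0 < α ∧ weightAbove f w g α < weightAbove f w h α ∧
    ∀ β, α < β → weightAbove f w g β = weightAbove f w h β

/-- `g` is the `lex_∞` isotonic regression of `(f, w)`: the isotonic function that strictly precedes
every other isotonic function in the lexical ordering. -/
def IsLexInf [Fintype V] (G : Digraph V) (f w g : V → ℝ) : Prop :=
  Isotonic G g ∧ ∀ h, Isotonic G h → h ≠ g → LexLT f w g h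

/-- `A`, which maps the data `f` and the positive weights `w` to a function on the vertices, is an
`L_∞` isotonic regression operator on `G`. -/
def IsLinfOperator (G : Digraph V) (A : (V → ℝ) → (V → ℝ) → V → ℝ) : Prop :=
  ∀ f w : V → ℝ, (∀ v, 0 < w v) → IsLinfRegression G f w (A f w)

/-- `A` is monotonic in the data, for every choice of positive weights. -/
def IsMonotonic (A : (V → ℝ) → (V → ℝ) → V → ℝ) : Prop :=
  ∀ w : V → ℝ, (∀ v, 0 < w v) → ∀ f g : V → ℝ, f ≤ g → A f w ≤ A g w

/-- `A` preserves level set trimming on `G`: on every level set `L` of `A f w` the regression value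
is the limit, as `p ↗ ∞`, of the weighted `L_p` means of `(f, w)` restricted to `L`. -/
def PreservesLevelSetTrimming (G : Digraph V) (A : (V → ℝ) → (V → ℝ) → V → ℝ) : Prop :=
  ∀ f w : V → ℝ, (∀ v, 0 < w v) → ∀ L : Finset V, IsLevelSet G (A f w) (L : Set V) →
    ∀ v ∈ L, IsWMeanUpInf f w L (A f w v)

end IsoReg

open Filter Topology

namespace IsoReg

variable {V : Type*}

/-! The core is a saddle property of limits of `L_p` regressions. Lowering an `L_p` regression
slightly on a set of vertices, where this keeps it monotone, cannot reduce the error, so a sum of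
signed `(p - 1)`-th powers of weighted errors over that set is nonnegative. As `p → ∞` the largest
error dominates the sum (`exists_le_of_eventually_sum_signedPow_nonneg`). Superlevel sets cut by
arbitrary lower sets make every limit point an up-saddle (`isUpSaddle_of_tendsto`); negating values
and reversing edges gives the dual saddle.

An up-saddle lies below a dual saddle for larger data (`IsUpSaddle.le`), since an upper set of one
and a lower set of the other meet in a set balanced for both. A monotonic trimming operator agrees
with every two-sided saddle (`operator_eq_of_isUpSaddle`): raising the data outside a lower set
isolates that set, and trimming then balances it. So all limit points of `L_p` regressions coincide
with its value, and compactness gives convergence. A two-sided saddle is also lexically least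
(`lexLT_of_isUpSaddle`). Conversely, saddle comparison gives monotonicity, and the first-order
condition on level sets gives trimming. -/

/-! ### First-order condition and its limit as `p → ∞`. -/

/-- The odd extension of `y ↦ y ^ (p - 1)` from `[0, ∞)` to `ℝ`. -/
noncomputable def signedPow (p y : ℝ) : ℝ := |y| ^ (p - 2) * y

lemma signedPow_neg (p y : ℝ) : signedPow p (-y) = -signedPow p y := by
  simp [signedPow]

lemma signedPow_of_pos (p : ℝ) {y : ℝ} (hy : 0 < y) : signedPow p y = y ^ (p - 1) := by
  rw [signedPow, abs_of_pos hy, ← Real.rpow_add_one hy.ne']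
  congr 1
  ring

lemma signedPow_le {p y b : ℝ} (hp : 1 < p) (hb : 0 < b) (h : y ≤ b) :
    signedPow p y ≤ b ^ (p - 1) := by
  rcases lt_or_ge 0 y with hy | hy
  · rw [signedPow_of_pos p hy]
    exact Real.rpow_le_rpow hy.le h (by linarith)
  · exact (mul_nonpos_of_nonneg_of_nonpos (by positivity) hy).trans (by positivity)

lemma signedPow_le_neg {p y b : ℝ} (hp : 1 < p) (hb : 0 < b) (h : y ≤ -b) :
    signedPow p y ≤ -b ^ (p - 1) := by
  have hy : 0 < -y := by linarith
  rw [← neg_neg y, signedPow_neg, signedPow_of_pos p hy, neg_le_neg_iff]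
  exact Real.rpow_le_rpow hb.le (by linarith) (by linarith)

lemma lpError_neg (p : ℝ) (f w : V → ℝ) (S : Finset V) (g : V → ℝ) :
    lpError p (-f) w S (-g) = lpError p f w S g := by
  refine Finset.sum_congr rfl fun v _ => ?_
  rw [Pi.neg_apply, Pi.neg_apply, ← abs_neg]
  ring_nf

lemma hasDerivAt_weighted_error {p w : ℝ} (hp : 1 < p) (hw : 0 < w) (f x : ℝ) :
    HasDerivAt (fun t : ℝ => (w * |f - (x - t)|) ^ p) (p * (w * signedPow p (w * (f - x)))) 0 := by
  have h1 : HasDerivAt (fun t : ℝ => w * (f - (x - t))) w 0 := by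
    have := (((hasDerivAt_id (0 : ℝ)).const_sub x).const_sub f).const_mul w
    simpa using this
  have h2 := (hasDerivAt_abs_rpow (w * (f - (x - 0))) hp).comp (0 : ℝ) h1
  have h3 : (fun t : ℝ => (w * |f - (x - t)|) ^ p) =
      (fun y : ℝ => |y| ^ p) ∘ fun t : ℝ => w * (f - (x - t)) := by
    funext t
    simp [abs_mul, abs_of_pos hw]
  rw [h3]
  refine h2.congr_deriv ?_
  simp only [signedPow, sub_zero]
  ring

lemma nonneg_deriv_of_eventually_le {F : ℝ → ℝ} {d : ℝ} (hd : HasDerivAt F d 0)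
    (h : ∀ᶠ t in 𝓝[>] (0 : ℝ), F 0 ≤ F t) : 0 ≤ d := by
  have h1 := (hasDerivWithinAt_iff_tendsto_slope' (by simp)).1 (hd.hasDerivWithinAt (s := Set.Ioi 0))
  refine ge_of_tendsto h1 ?_
  filter_upwards [h, self_mem_nhdsWithin] with t ht ht0
  rw [slope_def_field]
  have : (0 : ℝ) < t := ht0
  exact div_nonneg (by linarith) (by linarith)

/-- The first-order condition for a direction `-1_T`. -/
lemma sum_signedPow_nonneg {p : ℝ} (hp : 1 < p) {f w : V → ℝ} (hw : ∀ v, 0 < w v)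
    {S T : Finset V} (hTS : T ⊆ S) {g : V → ℝ}
    (h : ∀ᶠ t in 𝓝[>] (0 : ℝ), lpError p f w S g ≤
      lpError p f w S (fun v => g v - (T : Set V).indicator (fun _ => t) v)) :
    0 ≤ ∑ v ∈ T, w v * signedPow p (w v * (f v - g v)) := by
  classical
  have hd : HasDerivAt
      (fun t : ℝ => lpError p f w S (fun v => g v - (T : Set V).indicator (fun _ => t) v))
      (∑ v ∈ S, (T : Set V).indicator
        (fun v => p * (w v * signedPow p (w v * (f v - g v)))) v) 0 := by
    unfold lpError
    refine HasDerivAt.fun_sum fun v _ => ?_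
    by_cases hv : v ∈ (T : Set V)
    · simp only [Set.indicator_of_mem hv]
      exact hasDerivAt_weighted_error hp (hw v) (f v) (g v)
    · simp only [Set.indicator_of_notMem hv]
      exact hasDerivAt_const _ _
  have h0 := nonneg_deriv_of_eventually_le hd (by simpa using h)
  rw [Finset.sum_indicator_subset _ hTS, ← Finset.mul_sum] at h0
  exact nonneg_of_mul_nonneg_right h0 (by linarith)

/-- The limit of the first-order condition as `p → ∞`. -/
lemma exists_le_of_eventually_sum_signedPow_nonneg {l : Filter ℝ} [l.NeBot] (hl : l ≤ atTop)
    {f w : V → ℝ} (hw : ∀ v, 0 < w v) {r : ℝ → V → ℝ} {g : V → ℝ} (hr : Tendsto r l (𝓝 g))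
    (S : Finset V)
    (h : ∀ᶠ p in l, 0 ≤ ∑ v ∈ S, w v * signedPow p (w v * (f v - r p v))) {v : V} (hv : v ∈ S) :
    ∃ u ∈ S, w v * (g v - f v) ≤ w u * (f u - g u) := by
  classical
  by_contra! hc
  rw [tendsto_pi_nhds] at hr
  set d := w v * (g v - f v) with hd
  have hd0 : 0 < d := by
    have := hc v hv
    have e : w v * (f v - g v) = -d := by rw [hd]; ring
    linarith
  -- Two levels `b < b' < d` leave room on both sides: near the limit every positive term is at most
  -- `w u * b ^ (p - 1)`, while `v` contributes at most `-(w v * b' ^ (p - 1))`, which wins for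
  -- large `p`.
  obtain ⟨b, hb0, hbd, hb⟩ : ∃ b, 0 < b ∧ b < d ∧ ∀ u ∈ S, w u * (f u - g u) < b := by
    obtain ⟨m, hm, hmax⟩ := S.exists_max_image (fun u => w u * (f u - g u)) ⟨v, hv⟩
    obtain ⟨b, hb1, hb2⟩ := exists_between (max_lt hd0 (hc m hm))
    exact ⟨b, (le_max_left _ _).trans_lt hb1, hb2,
      fun u hu => (hmax u hu).trans_lt ((le_max_right _ _).trans_lt hb1)⟩
  obtain ⟨b', hbb', hb'd⟩ := exists_between hbd
  have hb'0 : 0 < b' := hb0.trans hbb'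
  have e1 : ∀ᶠ p in l, ∀ u ∈ S, w u * (f u - r p u) < b := by
    rw [Filter.eventually_all_finset]
    intro u hu
    exact (((hr u).const_sub (f u)).const_mul (w u)).eventually_lt_const (hb u hu)
  have e2 : ∀ᶠ p in l, b' < w v * (r p v - f v) :=
    (((hr v).sub_const (f v)).const_mul (w v)).eventually_const_lt hb'd
  have e3 : ∀ᶠ p in l, (∑ u ∈ S, w u) * (b / b') ^ (p - 1) < w v := by
    have t1 : Tendsto (fun p : ℝ => (b / b') ^ (p - 1)) l (𝓝 0) :=
      (tendsto_rpow_atTop_of_base_lt_one (b / b') (by linarith [div_pos hb0 hb'0])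
        ((div_lt_one hb'0).2 hbb')).comp ((tendsto_atTop_add_const_right _ (-1) tendsto_id).mono_left hl)
    have t2 := t1.const_mul (∑ u ∈ S, w u)
    rw [mul_zero] at t2
    exact t2.eventually_lt_const (hw v)
  obtain ⟨p, hp, h1, h2, h3, hp1⟩ :=
    (h.and (e1.and (e2.and (e3.and (hl (eventually_gt_atTop 1)))))).exists
  have hpos : 0 < b' ^ (p - 1) := Real.rpow_pos_of_pos hb'0 _
  rw [Real.div_rpow hb0.le hb'0.le, ← mul_div_assoc, div_lt_iff₀ hpos] at h3
  have k1 : w v * signedPow p (w v * (f v - r p v)) ≤ -(w v * b' ^ (p - 1)) := by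
    rw [← mul_neg]
    refine mul_le_mul_of_nonneg_left (signedPow_le_neg hp1 hb'0 ?_) (hw v).le
    have : w v * (f v - r p v) = -(w v * (r p v - f v)) := by ring
    linarith
  have k2 : ∑ u ∈ S.erase v, w u * signedPow p (w u * (f u - r p u)) ≤
      (∑ u ∈ S, w u) * b ^ (p - 1) := by
    rw [Finset.sum_mul]
    refine (Finset.sum_le_sum fun u hu => mul_le_mul_of_nonneg_left
      (signedPow_le hp1 hb0 (h1 u (Finset.mem_of_mem_erase hu)).le) (hw u).le).trans ?_
    refine Finset.sum_le_sum_of_subset_of_nonneg (Finset.erase_subset _ _) fun u _ _ => ?_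
    exact mul_nonneg (hw u).le (Real.rpow_nonneg hb0.le _)
  rw [← Finset.add_sum_erase S _ hv] at hp
  linarith

/-! ### Uniform bounds and existence of minimizers. -/

lemma continuous_lpError [Fintype V] {p : ℝ} (hp : 0 < p) (f w : V → ℝ) (S : Finset V) :
    Continuous (lpError p f w S) := by
  unfold lpError
  refine continuous_finsetSum _ fun v _ => Continuous.rpow_const (by fun_prop) fun _ => Or.inr hp.le

/-- A bound, uniform in `p`, for functions that are no worse than the zero function. -/
lemma weighted_error_le_of_lpError_le {p : ℝ} (hp : 1 < p) {f w : V → ℝ} (hw : ∀ v, 0 < w v)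
    {S : Finset V} {g : V → ℝ} (h : lpError p f w S g ≤ lpError p f w S 0) {v : V} (hv : v ∈ S) :
    w v * |f v - g v| ≤ S.card * ∑ u ∈ S, w u * |f u| := by
  have hn : ∀ u x, 0 ≤ w u * |x| := fun u x => mul_nonneg (hw u).le (abs_nonneg x)
  set K := ∑ u ∈ S, w u * |f u| with hK
  have hK0 : 0 ≤ K := Finset.sum_nonneg fun u _ => hn u _
  have hc : (1 : ℝ) ≤ S.card := by exact_mod_cast Finset.card_pos.2 ⟨v, hv⟩
  have h1 : (w v * |f v - g v|) ^ p ≤ lpError p f w S g :=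
    Finset.single_le_sum (f := fun u => (w u * |f u - g u|) ^ p)
      (fun u _ => Real.rpow_nonneg (hn u _) _) hv
  have h2 : lpError p f w S 0 ≤ S.card * K ^ p := by
    rw [← nsmul_eq_mul]
    refine Finset.sum_le_card_nsmul _ _ _ fun u hu => ?_
    rw [Pi.zero_apply, sub_zero]
    exact Real.rpow_le_rpow (hn u _)
      (Finset.single_le_sum (f := fun u => w u * |f u|) (fun u _ => hn u _) hu) (by linarith)
  -- Absorbing the cardinality into the base makes the final bound independent of `p`.
  have h3 : (S.card : ℝ) * K ^ p ≤ (S.card * K) ^ p := by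
    rw [Real.mul_rpow (by linarith) hK0]
    exact mul_le_mul_of_nonneg_right (Real.self_le_rpow_of_one_le hc hp.le)
      (Real.rpow_nonneg hK0 _)
  exact (Real.rpow_le_rpow_iff (hn v _) (by positivity) (by linarith)).1
    (h1.trans (h.trans (h2.trans h3)))

/-- The interval in which, for every `p`, the `L_p` approximations take their value at `v`. -/
noncomputable def errorInterval (f w : V → ℝ) (S : Finset V) (v : V) : Set ℝ :=
  Metric.closedBall (f v) (S.card * (∑ u ∈ S, w u * |f u|) / w v)

lemma mem_errorInterval {p : ℝ} (hp : 1 < p) {f w : V → ℝ} (hw : ∀ v, 0 < w v)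
    {S : Finset V} {g : V → ℝ} (h : lpError p f w S g ≤ lpError p f w S 0) {v : V} (hv : v ∈ S) :
    g v ∈ errorInterval f w S v := by
  have := weighted_error_le_of_lpError_le hp hw h hv
  rw [errorInterval, Metric.mem_closedBall, dist_comm, Real.dist_eq, le_div_iff₀ (hw v)]
  linarith

lemma exists_lpError_minimizer [Fintype V] {p : ℝ} (hp : 1 < p) (f : V → ℝ) {w : V → ℝ}
    (hw : ∀ v, 0 < w v) {C : Set (V → ℝ)} (hC : IsClosed C) (h0 : 0 ∈ C) :
    ∃ g ∈ C, ∀ h ∈ C, lpError p f w Finset.univ g ≤ lpError p f w Finset.univ h := by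
  have hcont := continuous_lpError (lt_trans one_pos hp) f w Finset.univ
  set D := C ∩ {g | lpError p f w Finset.univ g ≤ lpError p f w Finset.univ 0}
  have hD : IsCompact D := by
    refine (isCompact_univ_pi (s := errorInterval f w Finset.univ) fun v =>
      isCompact_closedBall _ _).of_isClosed_subset
        (hC.inter (isClosed_le hcont continuous_const)) ?_
    rintro g ⟨-, hg⟩ v -
    exact mem_errorInterval hp hw hg (Finset.mem_univ v)
  obtain ⟨g, hg, hmin⟩ := hD.exists_isMinOn ⟨0, h0, le_refl (lpError p f w Finset.univ 0)⟩ hcont.continuousOn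
  refine ⟨g, hg.1, fun h hh => ?_⟩
  rcases le_total (lpError p f w Finset.univ h) (lpError p f w Finset.univ 0) with h1 | h1
  · exact hmin ⟨hh, h1⟩
  · exact hg.2.trans h1

lemma exists_isWMean {p : ℝ} (hp : 1 < p) (f : V → ℝ) {w : V → ℝ} (hw : ∀ v, 0 < w v)
    (S : Finset V) : ∃ x, IsWMean p f w S x := by
  have hC : IsClosed {g : S → ℝ | ∀ u v, g u = g v} := by
    simp only [Set.ofPred_forall]
    exact isClosed_iInter fun u => isClosed_iInter fun v =>
      isClosed_eq (continuous_apply u) (continuous_apply v)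
  obtain ⟨g, hg, hmin⟩ := exists_lpError_minimizer hp (fun v : S => f v)
    (w := fun v : S => w v) (fun v => hw v) hC (by simp)
  rcases S.eq_empty_or_nonempty with rfl | ⟨v, hv⟩
  · exact ⟨0, fun y => by simp [lpError]⟩
  · refine ⟨g ⟨v, hv⟩, fun y => ?_⟩
    have h1 := hmin (fun _ => y) (by simp)
    have h2 : g = fun _ => g ⟨v, hv⟩ := funext fun u => hg u _
    rw [h2] at h1
    simp only [lpError] at h1 ⊢
    rwa [Finset.sum_coe_sort S (fun u => (w u * |f u - g ⟨v, hv⟩|) ^ p),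
      Finset.sum_coe_sort S (fun u => (w u * |f u - y|) ^ p)] at h1

/-! ### Minimizers along a relation, and the duality reversing edges and signs. -/

/-- `h` is monotone along the relation `r`. -/
def RelMono (r : V → V → Prop) (h : V → ℝ) : Prop := ∀ u v, r u v → h u ≤ h v

/-- `L` is closed under passing to `r`-predecessors. -/
def PredClosed (r : V → V → Prop) (L : Set V) : Prop := ∀ u v, r u v → v ∈ L → u ∈ L

lemma RelMono.neg {r : V → V → Prop} {h : V → ℝ} (hh : RelMono r h) : RelMono (flip r) (-h) :=
  fun u v huv => neg_le_neg (hh v u huv)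

lemma RelMono.predClosed_le {r : V → V → Prop} {h : V → ℝ} (hh : RelMono r h) (c : ℝ) :
    PredClosed r {x | h x ≤ c} :=
  fun u v huv hv => (hh u v huv).trans hv

lemma RelMono.predClosed_ge {r : V → V → Prop} {h : V → ℝ} (hh : RelMono r h) (c : ℝ) :
    PredClosed (flip r) {x | c ≤ h x} :=
  fun u v huv hv => le_trans (α := ℝ) hv (hh v u huv)

/-- `g` minimizes the `L_p` error among the functions that are monotone along `r`. -/
def IsLpMinimizer [Fintype V] (r : V → V → Prop) (p : ℝ) (f w g : V → ℝ) : Prop :=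
  RelMono r g ∧ ∀ h, RelMono r h → lpError p f w Finset.univ g ≤ lpError p f w Finset.univ h

lemma IsLpMinimizer.neg [Fintype V] {r : V → V → Prop} {p : ℝ} {f w g : V → ℝ}
    (hg : IsLpMinimizer r p f w g) : IsLpMinimizer (flip r) p (-f) w (-g) := by
  refine ⟨hg.1.neg, fun h hh => ?_⟩
  rw [lpError_neg, ← neg_neg h, lpError_neg]
  exact hg.2 _ hh.neg

lemma exists_isLpMinimizer [Fintype V] (r : V → V → Prop) {p : ℝ} (hp : 1 < p) (f : V → ℝ)
    {w : V → ℝ} (hw : ∀ v, 0 < w v) : ∃ g, IsLpMinimizer r p f w g := by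
  have hC : IsClosed {h : V → ℝ | RelMono r h} := by
    simp only [RelMono, Set.ofPred_forall]
    exact isClosed_iInter fun u => isClosed_iInter fun v => isClosed_iInter fun _ =>
      isClosed_le (continuous_apply u) (continuous_apply v)
  exact exists_lpError_minimizer hp f hw hC fun _ _ _ => le_rfl

/-- Every edge entering `T` has a strict increase, and there are finitely many edges, so lowering
`g` on `T` by a small `t` keeps it monotone. -/
lemma IsLpMinimizer.sum_signedPow_nonneg [Fintype V] {r : V → V → Prop} {p : ℝ} (hp : 1 < p)
    {f w g : V → ℝ} (hw : ∀ v, 0 < w v) (hg : IsLpMinimizer r p f w g) {T : Finset V}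
    (hT : ∀ a b, r a b → b ∈ T → a ∉ T → g a < g b) :
    0 ≤ ∑ v ∈ T, w v * signedPow p (w v * (f v - g v)) := by
  refine IsoReg.sum_signedPow_nonneg hp hw (Finset.subset_univ T) ?_
  have h1 : ∀ᶠ t in 𝓝[>] (0 : ℝ), ∀ a b, r a b → b ∈ T → a ∉ T → t < g b - g a := by
    simp only [eventually_all]
    exact fun a b hab hb ha => mem_nhdsWithin_of_mem_nhds
      (eventually_lt_nhds (sub_pos.2 (hT a b hab hb ha)))
  filter_upwards [h1, self_mem_nhdsWithin] with t ht (ht0 : 0 < t)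
  refine hg.2 _ fun a b hab => ?_
  have hab' := hg.1 a b hab
  by_cases ha : a ∈ (T : Set V) <;> by_cases hb : b ∈ (T : Set V)
  · simpa [ha, hb] using hab'
  · simp only [Set.indicator_of_mem ha, Set.indicator_of_notMem hb]
    linarith
  · simp only [Set.indicator_of_notMem ha, Set.indicator_of_mem hb]
    linarith [ht a b hab hb ha]
  · simpa [ha, hb] using hab'

/-! ### Balanced sets and saddles. -/

/-- At `c` the largest weighted error of `f` on `S` from above is at least the largest one from
below; that is, the minimizer of the `L_∞` error of constants on `S` is at least `c`. -/
def UpBalanced (f w : V → ℝ) (S : Set V) (c : ℝ) : Prop :=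
  ∀ v ∈ S, ∃ u ∈ S, w v * (c - f v) ≤ w u * (f u - c)

/-- If `c' < c`, passing from a vertex `v` maximizing `w v * (c' - f' v)` to a matching `u` for `c`,
and on to a matching `v'` for `c'`, strictly increases that maximum. -/
lemma UpBalanced.le [Finite V] {f f' w : V → ℝ} (hw : ∀ v, 0 < w v) (hf : f ≤ f') {S : Set V}
    (hS : S.Nonempty) {c c' : ℝ} (h : UpBalanced f w S c) (h' : UpBalanced (-f') w S (-c')) :
    c ≤ c' := by
  by_contra! hlt
  obtain ⟨v, hv, hmax⟩ := S.toFinite.exists_maximalFor (fun v => w v * (c' - f' v)) S hS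
  obtain ⟨u, hu, h1⟩ := h v hv
  obtain ⟨v', hv', h2⟩ := h' u hu
  have h3 : w v' * (c' - f' v') ≤ w v * (c' - f' v) := by
    rcases le_total (w v' * (c' - f' v')) (w v * (c' - f' v)) with h | h
    · exact h
    · exact hmax hv' h
  have h4 : w v * (c' - f' v) < w v * (c - f v) :=
    mul_lt_mul_of_pos_left (by linarith [hf v]) (hw v)
  have h5 : w u * (f u - c) < w u * (f' u - c') :=
    mul_lt_mul_of_pos_left (by linarith [hf u]) (hw u)
  simp only [Pi.neg_apply] at h2
  have e1 : w u * (-c' - -f' u) = w u * (f' u - c') := by ring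
  have e2 : w v' * (-f' v' - -c') = w v' * (c' - f' v') := by ring
  linarith

/-- For every `v` some `r`-upper set `U` on which `g` is at least `g v` has all its intersections
with lower sets containing `v` balanced upwards at `g v`. -/
def IsUpSaddle (r : V → V → Prop) (f w g : V → ℝ) : Prop :=
  ∀ v, ∃ U : Set V, v ∈ U ∧ PredClosed (flip r) U ∧ (∀ x ∈ U, g v ≤ g x) ∧
    ∀ L : Set V, v ∈ L → PredClosed r L → UpBalanced f w (U ∩ L) (g v)

lemma IsUpSaddle.le [Finite V] {r : V → V → Prop} {f f' w g g' : V → ℝ} (hw : ∀ v, 0 < w v)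
    (hg : IsUpSaddle r f w g) (hf : f ≤ f') (hg' : IsUpSaddle (flip r) (-f') w (-g')) :
    g ≤ g' := by
  intro v
  obtain ⟨U, hvU, hU, -, hUL⟩ := hg v
  obtain ⟨L, hvL, hL, -, hLU⟩ := hg' v
  refine UpBalanced.le (S := U ∩ L) hw hf ⟨v, hvU, hvL⟩ (hUL L hvL hL) ?_
  rw [Set.inter_comm]
  exact hLU U hvU hU

lemma isUpSaddle_of_tendsto [Fintype V] {r : V → V → Prop} {f w g : V → ℝ} (hw : ∀ v, 0 < w v)
    {l : Ultrafilter ℝ} (hl : (l : Filter ℝ) ≤ atTop) {ρ : ℝ → V → ℝ}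
    (hρ : ∀ p, 1 < p → IsLpMinimizer r p f w (ρ p)) (hlim : Tendsto ρ l (𝓝 g)) :
    IsUpSaddle r f w g := by
  intro v
  have hp1 : ∀ᶠ p in (l : Filter ℝ), 1 < p := hl (eventually_gt_atTop 1)
  -- `V` has finitely many subsets, so along an ultrafilter the superlevel set of `ρ p` at `v` is
  -- eventually a fixed set.
  obtain ⟨U, hU⟩ : ∃ U : Set V, ∀ᶠ p in (l : Filter ℝ), {x | ρ p v ≤ ρ p x} = U := by
    obtain ⟨U, hU⟩ := (l.map fun p => {x | ρ p v ≤ ρ p x}).eq_pure_of_finite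
    refine ⟨U, ?_⟩
    have : {U} ∈ l.map fun p => {x | ρ p v ≤ ρ p x} := by rw [hU]; exact Set.mem_singleton U
    exact this
  have hlim' := tendsto_pi_nhds.1 hlim
  have hge : ∀ x ∈ U, g v ≤ g x := by
    intro x hx
    refine le_of_tendsto_of_tendsto (hlim' v) (hlim' x) ?_
    filter_upwards [hU] with p hp
    rw [← hp] at hx
    exact hx
  obtain ⟨q, hq, hq1⟩ := (hU.and hp1).exists
  refine ⟨U, ?_, ?_, hge, fun L hvL hL => ?_⟩
  · rw [← hq]
    exact le_refl (ρ q v)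
  · rw [← hq]
    exact (hρ q hq1).1.predClosed_ge _
  · have key := fun x => exists_le_of_eventually_sum_signedPow_nonneg hl hw hlim
      (U ∩ L).toFinite.toFinset (v := x) (by
        filter_upwards [hU, hp1] with p hp hp1
        refine (hρ p hp1).sum_signedPow_nonneg hp1 hw fun a b hab hb ha => ?_
        rw [Set.Finite.mem_toFinset] at ha hb
        -- Since `L` is closed under predecessors, an edge can enter `U ∩ L` only by entering the
        -- superlevel set `U`, where `ρ p` strictly increases.
        have haU : a ∉ U := fun h => ha ⟨h, hL a b hab hb.2⟩
        have hbU := hb.1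
        rw [← hp] at haU hbU
        exact lt_of_lt_of_le (not_le.1 haU) hbU)
    intro x hx
    obtain ⟨u, hu, hux⟩ := key x (by simpa using hx)
    have hu : u ∈ U ∩ L := by simpa using hu
    refine ⟨u, hu, ?_⟩
    have h1 : w x * (g v - f x) ≤ w x * (g x - f x) :=
      mul_le_mul_of_nonneg_left (by linarith [hge x hx.1]) (hw x).le
    have h2 : w u * (f u - g u) ≤ w u * (f u - g v) :=
      mul_le_mul_of_nonneg_left (by linarith [hge u hu.1]) (hw u).le
    linarith

lemma isUpSaddle_neg_of_tendsto [Fintype V] {r : V → V → Prop} {f w g : V → ℝ}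
    (hw : ∀ v, 0 < w v) {l : Ultrafilter ℝ} (hl : (l : Filter ℝ) ≤ atTop) {ρ : ℝ → V → ℝ}
    (hρ : ∀ p, 1 < p → IsLpMinimizer r p f w (ρ p)) (hlim : Tendsto ρ l (𝓝 g)) :
    IsUpSaddle (flip r) (-f) w (-g) :=
  isUpSaddle_of_tendsto hw hl (ρ := fun p => -ρ p) (fun p hp => (hρ p hp).neg) hlim.neg

/-! ### Lexical minimality of saddles. -/

/-- Were the error of `g` at `v` at least `α`, then `h v < g v`, and the saddle on the lower set `h
≤ h v` would give a `u` where `h u ≤ h v < g v ≤ g u` and the error of `h` from above exceeds `α`.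
-/
lemma IsUpSaddle.lt_of_error_le [Finite V] {r : V → V → Prop} {f w g h : V → ℝ}
    (hw : ∀ v, 0 < w v) (hg : IsUpSaddle r f w g) (hh : RelMono r h) {α : ℝ}
    (hα : ∀ v, g v ≠ h v → w v * |h v - f v| ≤ α) {v : V} (hv : g v ≠ h v) (hvf : f v < g v) :
    w v * |g v - f v| < α := by
  by_contra! hc
  rw [abs_of_pos (sub_pos.2 hvf)] at hc
  have hlt : h v < g v := by
    refine lt_of_le_of_ne ?_ hv.symm
    by_contra! hgh
    have h1 := hα v hv
    rw [abs_of_pos (by linarith)] at h1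
    have h2 := mul_lt_mul_of_pos_left (show g v - f v < h v - f v by linarith) (hw v)
    linarith
  obtain ⟨U, hvU, -, hge, hUL⟩ := hg v
  obtain ⟨u, ⟨huU, huL⟩, hu⟩ := hUL {x | h x ≤ h v} (le_refl (h v)) (hh.predClosed_le _) v
    ⟨hvU, le_refl (h v)⟩
  have huL : h u ≤ h v := huL
  have h1 := mul_lt_mul_of_pos_left (show f u - g v < f u - h u by linarith) (hw u)
  have h2 : w u * (f u - h u) ≤ w u * |h u - f u| :=
    mul_le_mul_of_nonneg_left (by rw [abs_sub_comm]; exact le_abs_self _) (hw u).le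
  have h3 := hα u (by linarith [hge u huU] : h u < g u).ne'
  linarith

/-- A two-sided saddle precedes every other monotone function in the lexical ordering. -/
lemma lexLT_of_isUpSaddle [Fintype V] {r : V → V → Prop} {f w g h : V → ℝ}
    (hw : ∀ v, 0 < w v) (hg : IsUpSaddle r f w g) (hg' : IsUpSaddle (flip r) (-f) w (-g))
    (hh : RelMono r h) (hne : h ≠ g) : LexLT f w g h := by
  classical
  obtain ⟨v₀, hv₀⟩ : ∃ v, g v ≠ h v := by
    by_contra! hc
    exact hne (funext fun v => (hc v).symm)
  set D : Finset V := {v | g v ≠ h v} with hD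
  have hmem : ∀ v, v ∈ D ↔ g v ≠ h v := fun v => by simp [hD]
  obtain ⟨m, hm, hmax⟩ := D.exists_max_image
    (fun v => max (w v * |g v - f v|) (w v * |h v - f v|)) ⟨v₀, (hmem _).2 hv₀⟩
  -- The largest error of either function where they differ. It is attained by `h` only, so `m`
  -- counts for `h` and not for `g` at this level.
  set α := max (w m * |g m - f m|) (w m * |h m - f m|) with hαdef
  have hgα : ∀ v, g v ≠ h v → w v * |g v - f v| ≤ α := fun v hv =>
    (le_max_left _ _).trans (hmax v ((hmem v).2 hv))
  have hhα : ∀ v, g v ≠ h v → w v * |h v - f v| ≤ α := fun v hv =>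
    (le_max_right _ _).trans (hmax v ((hmem v).2 hv))
  have hα0 : 0 < α := by
    by_contra! hc
    have zero : ∀ y, w m * |y - f m| ≤ α → y = f m := fun y hy => by
      have h1 : w m * |y - f m| ≤ 0 := hy.trans hc
      have h2 : |y - f m| ≤ 0 := nonpos_of_mul_nonpos_right h1 (hw m)
      exact sub_eq_zero.1 (abs_nonpos_iff.1 h2)
    exact (hmem m).1 hm ((zero _ (le_max_left _ _)).trans (zero _ (le_max_right _ _)).symm)
  have key : ∀ v, g v ≠ h v → w v * |g v - f v| < α := by
    intro v hv
    rcases lt_trichotomy (f v) (g v) with h1 | h1 | h1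
    · exact hg.lt_of_error_le hw hh hhα hv h1
    · simpa [h1] using hα0
    · have e : ∀ x y : ℝ, |(-x) - (-y)| = |x - y| := fun x y => by
        rw [← abs_neg]; congr 1; ring
      have := hg'.lt_of_error_le (h := -h) (α := α) hw hh.neg (fun u hu => by
        simpa only [Pi.neg_apply, e] using hhα u (fun hc => hu (by simp [hc])))
        (v := v) (fun hc => hv (neg_injective hc)) (neg_lt_neg h1)
      simpa only [Pi.neg_apply, e] using this
  have hmα : α = w m * |h m - f m| := by
    rcases max_choice (w m * |g m - f m|) (w m * |h m - f m|) with h1 | h1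
    · exact absurd (hαdef.trans h1) (key m ((hmem m).1 hm)).ne'
    · exact hαdef.trans h1
  refine ⟨α, hα0, ?_, fun β hβ => ?_⟩
  · unfold weightAbove
    refine Finset.sum_lt_sum_of_subset (i := m) ?_ ?_ ?_ (hw m) fun v _ _ => (hw v).le
    · intro v hv
      rw [Finset.mem_filter] at hv ⊢
      refine ⟨hv.1, ?_⟩
      by_cases hgh : g v = h v
      · rw [← hgh]; exact hv.2
      · exact absurd hv.2 (not_le.2 (key v hgh))
    · simp [← hmα]
    · simpa using key m ((hmem m).1 hm)
  · unfold weightAbove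
    refine Finset.sum_congr (Finset.filter_congr fun v _ => ?_) fun _ _ => rfl
    by_cases hgh : g v = h v
    · rw [hgh]
    · exact ⟨fun hc => absurd hc (not_le.2 ((hgα v hgh).trans_lt hβ)),
        fun hc => absurd hc (not_le.2 ((hhα v hgh).trans_lt hβ))⟩

/-! ### Convergence of the `L_p` minimizers. -/

/-- The minimizers stay in a compact box independent of `p`, so each ultrafilter finer than `atTop`
has a limit, which is a two-sided saddle. -/
lemma tendsto_of_unique_saddle [Fintype V] {r : V → V → Prop} {f w g : V → ℝ}
    (hw : ∀ v, 0 < w v) {ρ : ℝ → V → ℝ} (hρ : ∀ p, 1 < p → IsLpMinimizer r p f w (ρ p))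
    (huniq : ∀ s, IsUpSaddle r f w s → IsUpSaddle (flip r) (-f) w (-s) → s = g) :
    Tendsto ρ atTop (𝓝 g) := by
  rw [tendsto_iff_ultrafilter]
  intro l hl
  have hbd : ∀ᶠ p in (l : Filter ℝ), ρ p ∈ Set.univ.pi (errorInterval f w Finset.univ) := by
    filter_upwards [hl (eventually_gt_atTop 1)] with p (hp : 1 < p) v _
    exact mem_errorInterval hp hw ((hρ p hp).2 0 fun _ _ _ => le_rfl) (Finset.mem_univ v)
  obtain ⟨s, -, hs⟩ := (isCompact_univ_pi (s := errorInterval f w Finset.univ) fun v =>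
    isCompact_closedBall _ _).ultrafilter_le_nhds' (l.map ρ) hbd
  have hs : Tendsto ρ l (𝓝 s) := hs
  rw [← huniq s (isUpSaddle_of_tendsto hw hl hρ hs) (isUpSaddle_neg_of_tendsto hw hl hρ hs)]
  exact hs

/-! ### Monotonic trimming operators against saddles. -/

/-- `A` gives an `L_∞` best approximation among the functions monotone along `r`. -/
def IsLinfMinimizing (r : V → V → Prop) (A : (V → ℝ) → (V → ℝ) → V → ℝ) : Prop :=
  ∀ f w : V → ℝ, (∀ v, 0 < w v) → RelMono r (A f w) ∧
    ∀ h, RelMono r h → linfError f w (A f w) ≤ linfError f w h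

/-- In every union of level sets of `A f w`, an error from below at `x` is matched by an error from
above at a vertex with the same regression value. -/
def TrimsUp (r : V → V → Prop) (A : (V → ℝ) → (V → ℝ) → V → ℝ) : Prop :=
  ∀ f w : V → ℝ, (∀ v, 0 < w v) → ∀ D : Set V,
    (∀ a b, r a b ∨ r b a → A f w a = A f w b → a ∈ D → b ∈ D) →
    ∀ x ∈ D, ∃ u ∈ D, A f w u = A f w x ∧ w x * (A f w x - f x) ≤ w u * (f u - A f w x)

lemma linfError_neg (f w g : V → ℝ) : linfError (-f) w (-g) = linfError f w g := by
  unfold linfError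
  congr 1
  funext v
  rw [Pi.neg_apply, Pi.neg_apply, ← abs_neg]
  ring_nf

lemma IsLinfMinimizing.neg {r : V → V → Prop} {A : (V → ℝ) → (V → ℝ) → V → ℝ}
    (hA : IsLinfMinimizing r A) : IsLinfMinimizing (flip r) (fun f w => -A (-f) w) := by
  refine fun f w hw => ⟨(hA (-f) w hw).1.neg, fun h hh => ?_⟩
  have h1 := (hA (-f) w hw).2 (-h) hh.neg
  rwa [linfError_neg, ← linfError_neg, neg_neg] at h1

lemma IsMonotonic.neg {A : (V → ℝ) → (V → ℝ) → V → ℝ} (hA : IsMonotonic A) :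
    IsMonotonic (fun f w => -A (-f) w) :=
  fun w hw f g hfg => neg_le_neg (hA w hw (-g) (-f) (neg_le_neg hfg))

/-- Raising the data far up outside a lower set `L` decouples `L` from its complement. -/
lemma exists_upBalanced_of_predClosed [Finite V] {r : V → V → Prop}
    {A : (V → ℝ) → (V → ℝ) → V → ℝ} (hA : IsLinfMinimizing r A) (hmono : IsMonotonic A)
    (htrim : TrimsUp r A) {f w : V → ℝ} (hw : ∀ v, 0 < w v) {L : Set V} (hL : PredClosed r L)
    (v : V) :
    ∃ U : Set V, v ∈ U ∧ PredClosed (flip r) U ∧ ∃ c, A f w v ≤ c ∧ UpBalanced f w (U ∩ L) c := by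
  classical
  have := Fintype.ofFinite V
  -- `E` bounds the error of a competitor that is `0` on `L` and equals the raised data outside. The
  -- height `2 * B + 1` then forces values at most `B` on `L` and above `B` outside.
  obtain ⟨E, hE⟩ := (Set.finite_range fun x => w x * |f x|).bddAbove
  have hE : ∀ x, w x * |f x| ≤ E := fun x => hE ⟨x, rfl⟩
  have hE0 : 0 ≤ E := (mul_nonneg (hw v).le (abs_nonneg _)).trans (hE v)
  obtain ⟨B, hB⟩ := (Set.finite_range fun x => |f x| + E / w x).bddAbove
  have hB : ∀ x, |f x| + E / w x ≤ B := fun x => hB ⟨x, rfl⟩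
  have hE1 : ∀ x, 0 ≤ E / w x := fun x => div_nonneg hE0 (hw x).le
  have hfB : ∀ x, f x ≤ B := fun x => by linarith [le_abs_self (f x), hB x, hE1 x]
  have hB0 : 0 ≤ B := by linarith [abs_nonneg (f v), hB v, hE1 v]
  set F : V → ℝ := fun x => if x ∈ L then f x else 2 * B + 1 with hF
  have hfF : f ≤ F := by
    intro x
    by_cases hx : x ∈ L
    · simp [hF, hx]
    · simp only [hF, hx, if_false]
      linarith [hfB x]
  set g := A F w with hgdef
  have herr : ∀ x, |F x - g x| ≤ E / w x := by
    intro x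
    have h1 := (hA F w hw).2 (fun x => if x ∈ L then 0 else 2 * B + 1) (by
      intro a b hab
      by_cases hb : b ∈ L
      · simp [hb, hL a b hab hb]
      · simp only [hb, if_false]
        split_ifs <;> linarith)
    have h2 : linfError F w (fun x => if x ∈ L then 0 else 2 * B + 1) ≤ E := by
      have : Nonempty V := ⟨v⟩
      refine ciSup_le fun y => ?_
      by_cases hy : y ∈ L
      · simpa [hF, hy] using hE y
      · simpa [hF, hy] using hE0
    have h3 : w x * |F x - g x| ≤ linfError F w g :=
      le_ciSup (f := fun x => w x * |F x - g x|) (Set.finite_range _).bddAbove x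
    rw [le_div_iff₀ (hw x)]
    linarith
  have hlow : ∀ x ∈ L, g x ≤ B := by
    intro x hx
    have h1 := (abs_le.1 (herr x)).1
    simp only [hF, hx, if_true] at h1
    linarith [hB x, le_abs_self (f x)]
  have hhigh : ∀ x ∉ L, B < g x := by
    intro x hx
    have h1 := (abs_le.1 (herr x)).2
    simp only [hF, hx, if_false] at h1
    linarith [hB x, abs_nonneg (f x)]
  refine ⟨{x | g v ≤ g x}, le_refl (g v), (hA F w hw).1.predClosed_ge _, g v,
    hmono w hw f F hfF v, ?_⟩
  intro x hx
  -- The gap at `B` prevents equal values across the boundary of `L`, so the superlevel set cut by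
  -- `L` is a union of level sets of `A F w` and trimming applies. Lowering the comparison value
  -- from `g x` to `g v` only helps.
  obtain ⟨u, hu, hux, hle⟩ := htrim F w hw ({x | g v ≤ g x} ∩ L) (by
    rintro a b - hab ⟨ha, haL⟩
    refine ⟨le_trans (α := ℝ) ha hab.le, ?_⟩
    by_contra hb
    exact absurd hab ((hlow a haL).trans_lt (hhigh b hb)).ne) x hx
  refine ⟨u, hu, ?_⟩
  have hxF : F x = f x := by simp [hF, hx.2]
  have huF : F u = f u := by simp [hF, hu.2]
  have hgx : g v ≤ g x := hx.1
  rw [hxF, huF] at hle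
  have h1 : w x * (g v - f x) ≤ w x * (g x - f x) :=
    mul_le_mul_of_nonneg_left (by linarith) (hw x).le
  have h2 : w u * (f u - g x) ≤ w u * (f u - g v) :=
    mul_le_mul_of_nonneg_left (by linarith) (hw u).le
  linarith

/-- The lower set `L` comes from the dual saddle and the upper set `U` from the decoupled operator;
`U ∩ L` is balanced upwards at some `c ≥ A f w v` and downwards at `s v`. -/
lemma operator_le_of_isUpSaddle_neg [Finite V] {r : V → V → Prop}
    {A : (V → ℝ) → (V → ℝ) → V → ℝ} (hA : IsLinfMinimizing r A) (hmono : IsMonotonic A)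
    (htrim : TrimsUp r A) {f w s : V → ℝ} (hw : ∀ v, 0 < w v)
    (hs : IsUpSaddle (flip r) (-f) w (-s)) : A f w ≤ s := by
  intro v
  obtain ⟨L, hvL, hL, -, hLU⟩ := hs v
  obtain ⟨U, hvU, hU, c, hc, hbal⟩ := exists_upBalanced_of_predClosed hA hmono htrim hw hL v
  refine hc.trans (UpBalanced.le (S := U ∩ L) hw (le_refl f) ⟨v, hvU, hvL⟩ hbal ?_)
  rw [Set.inter_comm]
  exact hLU U hvU hU

lemma operator_eq_of_isUpSaddle [Finite V] {r : V → V → Prop}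
    {A : (V → ℝ) → (V → ℝ) → V → ℝ} (hA : IsLinfMinimizing r A) (hmono : IsMonotonic A)
    (htrim : TrimsUp r A) (htrim' : TrimsUp (flip r) fun f w => -A (-f) w) {f w s : V → ℝ}
    (hw : ∀ v, 0 < w v) (hs : IsUpSaddle r f w s) (hs' : IsUpSaddle (flip r) (-f) w (-s)) :
    s = A f w := by
  refine le_antisymm ?_ (operator_le_of_isUpSaddle_neg hA hmono htrim hw hs')
  have h1 := operator_le_of_isUpSaddle_neg hA.neg hmono.neg htrim' hw (f := -f) (s := -s)
    (by rw [neg_neg, neg_neg]; exact hs)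
  simpa using h1

/-! ### Isotonic functions and level sets. -/

lemma isotonic_iff_relMono {G : Digraph V} {h : V → ℝ} : Isotonic G h ↔ RelMono G.Adj h := by
  refine ⟨fun hh u v huv => hh u v (.single huv), fun hh u v huv => ?_⟩
  induction huv with
  | single h => exact hh _ _ h
  | tail _ h ih => exact ih.trans (hh _ _ h)

lemma isLpRegression_iff [Fintype V] {G : Digraph V} {p : ℝ} {f w g : V → ℝ} :
    IsLpRegression G p f w g ↔ IsLpMinimizer G.Adj p f w g := by
  simp only [IsLpRegression, IsLpMinimizer, isotonic_iff_relMono]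

lemma IsLinfOperator.isLinfMinimizing {G : Digraph V} {A : (V → ℝ) → (V → ℝ) → V → ℝ}
    (hA : IsLinfOperator G A) : IsLinfMinimizing G.Adj A := by
  intro f w hw
  have := hA f w hw
  simpa only [IsLinfRegression, isotonic_iff_relMono] using this

/-- Every vertex lies in a level set, which is contained in every set containing the vertex and
closed under adjacency at equal values. -/
lemma exists_isLevelSet (G : Digraph V) (g : V → ℝ) (x : V) :
    ∃ K : Set V, IsLevelSet G g K ∧ x ∈ K ∧ (∀ y ∈ K, g y = g x) ∧
      ∀ D : Set V, (∀ a b, G.Adj a b ∨ G.Adj b a → g a = g b → a ∈ D → b ∈ D) → x ∈ D → K ⊆ D := by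
  -- Its edges join adjacent vertices of equal value; the level set is the component of `x`.
  let H : SimpleGraph V :=
    { Adj := fun a b => G.toSimpleGraphInclusive.Adj a b ∧ g a = g b
      symm := ⟨fun a b h => ⟨h.1.symm, h.2.symm⟩⟩
      loopless := ⟨fun a h => h.1.ne rfl⟩ }
  set C := H.connectedComponentMk x with hC
  have hmem : ∀ y, y ∈ C.supp ↔ H.Reachable x y := fun y => by
    rw [SimpleGraph.ConnectedComponent.mem_supp_iff, hC, SimpleGraph.ConnectedComponent.eq]
    exact SimpleGraph.reachable_comm
  have hind : ∀ D : Set V, (∀ a b, H.Adj a b → a ∈ D → b ∈ D) → x ∈ D → C.supp ⊆ D := by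
    intro D hD hx y hy
    have hwalk : ∀ {a b : V}, H.Walk a b → a ∈ D → b ∈ D := fun q => by
      induction q with
      | nil => exact id
      | cons h _ ih => exact fun ha => ih (hD _ _ h ha)
    obtain ⟨q⟩ := (hmem y).1 hy
    exact hwalk q hx
  have hconst : ∀ y ∈ C.supp, g y = g x := fun y hy =>
    hind {y | g y = g x} (fun a b h ha => h.2.symm.trans ha) rfl hy
  refine ⟨C.supp, ⟨⟨?_, fun u hu v hv => (hconst u hu).trans (hconst v hv).symm⟩, ?_⟩,
    (hmem x).2 .rfl, hconst, fun D hD hx => hind D (fun a b h ha => ?_) hx⟩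
  · refine C.connected_toSimpleGraph.mono fun a b h => ?_
    exact And.left h
  · rintro T ⟨hT, hTc⟩ hCT y hy
    rw [hmem]
    have hxT : x ∈ T := hCT ((hmem x).2 .rfl)
    let φ : G.toSimpleGraphInclusive.induce T →g H :=
      ⟨Subtype.val, fun {a b} h => ⟨h, hTc a a.2 b b.2⟩⟩
    exact (hT.preconnected ⟨x, hxT⟩ ⟨y, hy⟩).map φ
  · exact hD a b (SimpleGraph.fromRel_adj _ _ _ |>.1 h.1).2 h.2 ha

lemma IsLevelSet.mem_of_adj {G : Digraph V} {g : V → ℝ} {K : Set V} (hK : IsLevelSet G g K)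
    {a b : V} (ha : a ∈ K) (hab : G.Adj a b ∨ G.Adj b a) (hg : g a = g b) : b ∈ K := by
  rcases eq_or_ne a b with rfl | hne
  · exact ha
  have hadj : G.toSimpleGraphInclusive.Adj a b := (SimpleGraph.fromRel_adj _ _ _).2 ⟨hne, hab⟩
  have hval : ∀ x ∈ K ∪ {a, b}, g x = g a := by
    rintro x (hx | rfl | rfl)
    · exact hK.prop.2 x hx a ha
    · rfl
    · exact hg.symm
  refine hK.2 (y := K ∪ {a, b}) ⟨?_, fun u hu v hv => (hval u hu).trans (hval v hv).symm⟩
    Set.subset_union_left (Or.inr (Or.inr rfl))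
  exact SimpleGraph.induce_union_connected hK.prop.1.preconnected
    (SimpleGraph.induce_pair_connected_of_adj hadj).preconnected ⟨a, ha, Or.inl rfl⟩

/-! ### Limits of weighted means. -/

lemma IsWMean.neg {p : ℝ} {f w : V → ℝ} {S : Finset V} {x : ℝ} (h : IsWMean p f w S x) :
    IsWMean p (-f) w S (-x) := by
  intro y
  have h1 := h (-y)
  rw [← lpError_neg, ← lpError_neg p f] at h1
  simpa [Pi.neg_def] using h1

lemma IsWMean.sum_signedPow_nonneg {p : ℝ} (hp : 1 < p) {f w : V → ℝ} (hw : ∀ v, 0 < w v)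
    {S : Finset V} {x : ℝ} (h : IsWMean p f w S x) :
    0 ≤ ∑ v ∈ S, w v * signedPow p (w v * (f v - x)) := by
  refine IsoReg.sum_signedPow_nonneg (g := fun _ => x) hp hw (Finset.Subset.refl S)
    (Eventually.of_forall fun t => (h (x - t)).trans_eq ?_)
  refine Finset.sum_congr rfl fun v hv => ?_
  simp only [Set.indicator_of_mem (Finset.mem_coe.2 hv)]

lemma upBalanced_of_tendsto_isWMean {l : Filter ℝ} [l.NeBot] (hl : l ≤ atTop) {f w : V → ℝ}
    (hw : ∀ v, 0 < w v) {S : Finset V} {m : ℝ → ℝ} (hm : ∀ p, 1 < p → IsWMean p f w S (m p))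
    {c : ℝ} (hc : Tendsto m l (𝓝 c)) : UpBalanced f w S c := fun _ hv =>
  exists_le_of_eventually_sum_signedPow_nonneg hl hw (r := fun p _ => m p) (g := fun _ => c)
    (tendsto_pi_nhds.2 fun _ => hc) S
    (by filter_upwards [hl (eventually_gt_atTop 1)] with p hp
        exact (hm p hp).sum_signedPow_nonneg hp hw) hv

lemma IsWMeanUpInf.upBalanced {f w : V → ℝ} (hw : ∀ v, 0 < w v) {S : Finset V} {c : ℝ}
    (h : IsWMeanUpInf f w S c) : UpBalanced f w S c := by
  obtain ⟨m, hm, hc⟩ := h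
  exact upBalanced_of_tendsto_isWMean le_rfl hw hm hc

lemma IsWMeanUpInf.neg {f w : V → ℝ} {S : Finset V} {c : ℝ}
    (h : IsWMeanUpInf f w S c) : IsWMeanUpInf (-f) w S (-c) := by
  obtain ⟨m, hm, hc⟩ := h
  exact ⟨fun p => -m p, fun p hp => (hm p hp).neg, hc.neg⟩

/-- Any ultrafilter limit of the means is balanced in both directions, and `UpBalanced.le` used
twice shows that only one value is. -/
lemma isWMeanUpInf_of_upBalanced [Finite V] {f w : V → ℝ} (hw : ∀ v, 0 < w v) {S : Finset V}
    (hS : S.Nonempty) {c : ℝ} (h : UpBalanced f w S c) (h' : UpBalanced (-f) w S (-c)) :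
    IsWMeanUpInf f w S c := by
  choose! m hm using fun (p : ℝ) (hp : 1 < p) => exists_isWMean hp f hw S
  refine ⟨m, hm, ?_⟩
  rw [tendsto_iff_ultrafilter]
  intro l hl
  obtain ⟨v, hv⟩ := hS
  have hbd : ∀ᶠ p in (l : Filter ℝ), m p ∈ errorInterval f w S v := by
    filter_upwards [hl (eventually_gt_atTop 1)] with p (hp : 1 < p)
    exact mem_errorInterval (g := fun _ => m p) hp hw (hm p hp 0) hv
  obtain ⟨d, -, hd⟩ := IsCompact.ultrafilter_le_nhds' (s := errorInterval f w S v)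
    (isCompact_closedBall _ _) (l.map m) hbd
  have hd : Tendsto m l (𝓝 d) := hd
  have h1 := upBalanced_of_tendsto_isWMean hl hw hm hd
  have h2 := upBalanced_of_tendsto_isWMean hl hw (m := fun p => -m p)
    (fun p hp => (hm p hp).neg) hd.neg
  have hdc : d = c := le_antisymm (h1.le hw le_rfl ⟨v, hv⟩ h') (h.le hw le_rfl ⟨v, hv⟩ h2)
  rwa [← hdc]

/-! ### Trimming and strict regressions on level sets. -/

lemma PreservesLevelSetTrimming.trimsUp [Finite V] {G : Digraph V}
    {A : (V → ℝ) → (V → ℝ) → V → ℝ} (hA : PreservesLevelSetTrimming G A) : TrimsUp G.Adj A := by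
  intro f w hw D hD x hx
  obtain ⟨K, hK, hxK, hconst, hsub⟩ := exists_isLevelSet G (A f w) x
  lift K to Finset V using K.toFinite
  obtain ⟨u, hu, hle⟩ := (hA f w hw K hK x hxK).upBalanced hw x hxK
  exact ⟨u, hsub D hD hx hu, hconst u hu, hle⟩

lemma PreservesLevelSetTrimming.trimsUp_neg [Finite V] {G : Digraph V}
    {A : (V → ℝ) → (V → ℝ) → V → ℝ} (hA : PreservesLevelSetTrimming G A) :
    TrimsUp (flip G.Adj) fun f w => -A (-f) w := by
  intro f w hw D hD x hx
  obtain ⟨K, hK, hxK, hconst, hsub⟩ := exists_isLevelSet G (A (-f) w) x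
  lift K to Finset V using K.toFinite
  have hb := (hA (-f) w hw K hK x hxK).neg.upBalanced hw
  rw [neg_neg] at hb
  obtain ⟨u, hu, hle⟩ := hb x hxK
  refine ⟨u, hsub D (fun a b hab hg ha => hD a b hab.symm ?_ ha) hx hu, ?_, hle⟩
  · exact congrArg Neg.neg hg
  · exact congrArg Neg.neg (hconst u hu)

/-- A level set of a limit of `L_p` regressions is balanced at its value. -/
lemma upBalanced_of_closed_of_tendsto [Fintype V] {r : V → V → Prop} {f w g : V → ℝ}
    (hw : ∀ v, 0 < w v) {ρ : ℝ → V → ℝ} (hρ : ∀ p, 1 < p → IsLpMinimizer r p f w (ρ p))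
    (hlim : Tendsto ρ atTop (𝓝 g)) (hg : RelMono r g) {K : Finset V} {c : ℝ}
    (hc : ∀ v ∈ K, g v = c) (hK : ∀ a b, r a b → b ∈ K → g a = g b → a ∈ K) :
    UpBalanced f w K c := by
  intro v hv
  have hlim' := tendsto_pi_nhds.1 hlim
  -- An edge entering `K` increases strictly in the limit, hence also for large `p`; so lowering on
  -- `K` is admissible.
  have hlt : ∀ᶠ p in atTop, ∀ a b, r a b → b ∈ K → a ∉ K → ρ p a < ρ p b := by
    simp only [eventually_all]
    exact fun a b hab hb ha => (hlim' a).eventually_lt (hlim' b)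
      (lt_of_le_of_ne (hg a b hab) fun h => ha (hK a b hab hb h))
  obtain ⟨u, hu, hle⟩ := exists_le_of_eventually_sum_signedPow_nonneg le_rfl hw hlim K (by
    filter_upwards [hlt, eventually_gt_atTop 1] with p hp hp1
    exact (hρ p hp1).sum_signedPow_nonneg hp1 hw hp) hv
  rw [hc v hv, hc u hu] at hle
  exact ⟨u, hu, hle⟩

lemma IsStrictUpInf.isWMeanUpInf [Fintype V] {G : Digraph V} {f w g : V → ℝ}
    (hw : ∀ v, 0 < w v) (hg : Isotonic G g) (h : IsStrictUpInf G f w g) {K : Finset V}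
    (hK : IsLevelSet G g (K : Set V)) {v : V} (hv : v ∈ K) : IsWMeanUpInf f w K (g v) := by
  obtain ⟨ρ, hρ, hlim⟩ := h
  have hρ := fun p hp => isLpRegression_iff.1 (hρ p hp)
  have hg := isotonic_iff_relMono.1 hg
  have hc : ∀ u ∈ K, g u = g v := fun u hu => hK.prop.2 u hu v hv
  refine isWMeanUpInf_of_upBalanced hw ⟨v, hv⟩ ?_ ?_
  · exact upBalanced_of_closed_of_tendsto hw hρ hlim hg hc fun a b hab hb h =>
      hK.mem_of_adj hb (Or.inr hab) h.symm
  · exact upBalanced_of_closed_of_tendsto hw (ρ := fun p => -ρ p) (fun p hp => (hρ p hp).neg)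
      hlim.neg hg.neg (fun u hu => congrArg Neg.neg (hc u hu)) fun a b hab hb h =>
      hK.mem_of_adj hb (Or.inl hab) (neg_injective h).symm

lemma IsStrictUpInf.isUpSaddle [Fintype V] {G : Digraph V} {f w g : V → ℝ}
    (hw : ∀ v, 0 < w v) (h : IsStrictUpInf G f w g) :
    IsUpSaddle G.Adj f w g ∧ IsUpSaddle (flip G.Adj) (-f) w (-g) := by
  obtain ⟨ρ, hρ, hlim⟩ := h
  obtain ⟨l, hl⟩ := Ultrafilter.exists_le (atTop : Filter ℝ)
  have hρ := fun p hp => isLpRegression_iff.1 (hρ p hp)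
  exact ⟨isUpSaddle_of_tendsto hw hl hρ (hlim.mono_left hl),
    isUpSaddle_neg_of_tendsto hw hl hρ (hlim.mono_left hl)⟩

end IsoReg

/-- An `L_∞` isotonic regression operator on a finite dag is monotonic and preserves level set
trimming iff it always produces the strict `L_∞` isotonic regression; and then it always produces
the `lex_∞` isotonic regression. -/
theorem mainTheorem1 {V : Type*} [Fintype V] (G : Digraph V) (hG : IsoReg.Acyclic G)
    (A : (V → ℝ) → (V → ℝ) → V → ℝ) (hA : IsoReg.IsLinfOperator G A) :
    ((IsoReg.IsMonotonic A ∧ IsoReg.PreservesLevelSetTrimming G A) ↔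
      ∀ f w : V → ℝ, (∀ v, 0 < w v) → IsoReg.IsStrictUpInf G f w (A f w)) ∧
    ((IsoReg.IsMonotonic A ∧ IsoReg.PreservesLevelSetTrimming G A) →
      ∀ f w : V → ℝ, (∀ v, 0 < w v) → IsoReg.IsLexInf G f w (A f w)) := by
  have strict : (IsoReg.IsMonotonic A ∧ IsoReg.PreservesLevelSetTrimming G A) →
      ∀ f w : V → ℝ, (∀ v, 0 < w v) → IsoReg.IsStrictUpInf G f w (A f w) := by
    rintro ⟨hmono, htrim⟩ f w hw
    choose! ρ hρ using fun (p : ℝ) (hp : 1 < p) => IsoReg.exists_isLpMinimizer G.Adj hp f hw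
    exact ⟨ρ, fun p hp => IsoReg.isLpRegression_iff.2 (hρ p hp),
      IsoReg.tendsto_of_unique_saddle hw hρ fun s hs hs' =>
        IsoReg.operator_eq_of_isUpSaddle hA.isLinfMinimizing hmono htrim.trimsUp
          htrim.trimsUp_neg hw hs hs'⟩
  refine ⟨⟨strict, fun h => ⟨fun w hw f g hfg => ?_, fun f w hw L hL v hv => ?_⟩⟩,
    fun h f w hw => ⟨(hA f w hw).1, fun k hk hne => ?_⟩⟩
  · exact ((h f w hw).isUpSaddle hw).1.le hw hfg ((h g w hw).isUpSaddle hw).2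
  · exact (h f w hw).isWMeanUpInf hw (hA f w hw).1 hL hv
  · obtain ⟨h1, h2⟩ := (strict h f w hw).isUpSaddle hw
    exact IsoReg.lexLT_of_isUpSaddle hw h1 h2 (IsoReg.isotonic_iff_relMono.1 hk) hne
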